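/- Let $\mathsf P_*\subset\mathbb R^2$ be a compact convex set whose boundary $\partial\mathsf P_*$ is a curve of class $C^1$ (a regular simple closed $C^1$ curve); no symmetry or strict convexity is assumed. Put $$m:=\int_{\mathsf P_*}dy,\qquad J:=\int_{\mathsf P_*}|y|^2\,dy .$$ For $\theta,\psi\in\mathbb S^1$ let $R(\theta)=\begin{pmatrix}\cos\theta&-\sin\theta\\ \sin\theta&\cos\theta\end{pmatrix}$ and $e(\psi)=(\cos\psi,\sin\psi)$. For $\beta=(\psi,\vartheta,\overline\vartheta)\in\mathbb T^3=(\mathbb S^1)^3$ let $$d_\beta:=\inf\{d>0 : R(\vartheta)\mathsf P_*\cap(R(\overline\vartheta)\mathsf P_*+d\,e(\psi))=\varnothing\}.$$ Let $M:=\mathrm{diag}(\sqrt m,\sqrt m,\sqrt m,\sqrt m,\sqrt J,\sqrt J)$, $\widehat E_1:=\tfrac1{\sqrt2}(1,0,1,0,0,0)^T$, $\widehat E_2:=\tfrac1{\sqrt2}(0,1,0,1,0,0)^T$ and $$\widehat E_\beta:=\frac{1}{\sqrt{2md_\beta^2+8J}}\left(\sqrt m\,d_\beta\sin\psi,\,-\sqrt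 m\,d_\beta\cos\psi,\,-\sqrt m\,d_\beta\sin\psi,\,\sqrt m\,d_\beta\cos\psi,\,2\sqrt J,\,2\sqrt J\right)^T .$$ The non-canonical physical scattering family is $\mathscr S_\times=\{\sigma_\beta^\times\}_{\beta\in\mathbb T^3}$, where $\sigma^\times_\beta:\mathbb R^6\to\mathbb R^6$ is the linear map $$\sigma_\beta^\times[V]:=M^{-1}\left(2\widehat E_1\otimes\widehat E_1+2\widehat E_2\otimes\widehat E_2+2\widehat E_\beta\otimes\widehat E_\beta-I_6\right)MV .$$ For $V=[v,\overline v,\omega,\overline\omega]$ with $v,\overline v\in\mathbb R^2$ and $\omega,\overline\omega\in\mathbb R$, write $\sigma_\beta^\times[V]=[v'_\beta,\overline v'_\beta,\omega'_\beta,\overline\omega'_\beta]$. Suppose that $\varphi\in C^1(\mathbb R^2\times\mathbb R\times\mathbb S^1)$ is real-valued and is an $\mathscr S_\times$-collision invariant, i.e. $$\varphi(v'_\beta,\omega'_\beta,\vartheta)+\varphi(\overline v'_\beta,\overline\omega'_\beta,\overline\vartheta)=\varphi(v,\omega,\vartheta)+\varphi(\overline v,\overline\omega,\overline\vartheta)$$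 for all $v,\overline v\in\mathbb R^2$, all $\omega,\overline\omega\in\mathbb R$ and all $\beta=(\psi,\vartheta,\overline\vartheta)\in\mathbb T^3$. Then there are $a\in C^1(\mathbb S^1)$, $b\in\mathbb R^2$ and $c\in\mathbb R$ such that $$\varphi(v,\omega,\vartheta)=a(\vartheta)+b\cdot v+c\left(m|v|^2+J\omega^2\right)$$ for all $v\in\mathbb R^2$, $\omega\in\mathbb R$ and $\vartheta\in\mathbb S^1$. -/

import Mathlib

open MeasureTheory
open scoped Manifold

noncomputable section

/-- The Euclidean plane. -/
abbrev Plane : Type := EuclideanSpace ℝ (Fin 2)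

/-- A regular simple closed curve of class `C¹` in the plane: the trace of a `2π`-periodic `C¹`
map which is injective on a period and whose velocity never vanishes. -/
def IsC1ClosedCurve (S : Set Plane) : Prop :=
  ∃ γ : ℝ → Plane,
    ContDiff ℝ 1 γ ∧
    Function.Periodic γ (2 * Real.pi) ∧
    Set.InjOn γ (Set.Ico 0 (2 * Real.pi)) ∧
    (∀ t, deriv γ t ≠ 0) ∧
    Set.range γ = S

/-- A reference particle: a compact convex planar set whose boundary is a curve of class `C¹`. -/
structure IsReferenceParticle (P : Set Plane) : Prop where
  isCompact : IsCompact P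
  convex : Convex ℝ P
  boundary : IsC1ClosedCurve (frontier P)

/-- The mass `m = ∫_P dy`. -/
def particleMass (P : Set Plane) : ℝ := ∫ _y in P, (1 : ℝ)

/-- The scalar inertia `J = ∫_P |y|² dy`. -/
def particleInertia (P : Set Plane) : ℝ := ∫ y in P, ‖y‖ ^ 2

/-- The cosine of an angle, an angle `θ` being given by the point `exp (i θ)` of the unit circle. -/
def angleCos (θ : Circle) : ℝ := (θ : ℂ).re

/-- The sine of an angle, an angle `θ` being given by the point `exp (i θ)` of the unit circle. -/
def angleSin (θ : Circle) : ℝ := (θ : ℂ).im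

/-- The rotation `R(θ)`, applied to `y`. -/
def rotatePlane (θ : Circle) (y : Plane) : Plane :=
  !₂[angleCos θ * y 0 - angleSin θ * y 1, angleSin θ * y 0 + angleCos θ * y 1]

/-- The unit vector `e(ψ) = (cos ψ, sin ψ)`. -/
def direction (ψ : Circle) : Plane := !₂[angleCos ψ, angleSin ψ]

/-- A collision parameter `β = (ψ, ϑ, ϑ')`: the elevation angle and the orientations of the two
particles. -/
structure CollisionParameter where
  elevation : Circle
  orientation : Circle
  orientation' : Circle

/-- The distance of closest approach `d_β`: the infimum of all `d > 0` for which `R(ϑ) P` and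
`R(ϑ') P + d e(ψ)` are disjoint. -/
def closestDistance (P : Set Plane) (β : CollisionParameter) : ℝ :=
  sInf {d : ℝ | 0 < d ∧
    (rotatePlane β.orientation '' P) ∩
      ((fun y => rotatePlane β.orientation' y + d • direction β.elevation) '' P) = ∅}

/-- The mass-inertia matrix `M`. -/
def massInertiaMatrix (P : Set Plane) : Matrix (Fin 6) (Fin 6) ℝ :=
  Matrix.diagonal ![√(particleMass P), √(particleMass P), √(particleMass P), √(particleMass P),
    √(particleInertia P), √(particleInertia P)]

/-- The unit vector `E₁`. -/
def vecE₁ : Fin 6 → ℝ := (1 / √2 : ℝ) • ![1, 0, 1, 0, 0, 0]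

/-- The unit vector `E₂`. -/
def vecE₂ : Fin 6 → ℝ := (1 / √2 : ℝ) • ![0, 1, 0, 1, 0, 0]

/-- The unit vector `E_β`. -/
def vecEβ (P : Set Plane) (β : CollisionParameter) : Fin 6 → ℝ :=
  (1 / √(2 * particleMass P * closestDistance P β ^ 2 + 8 * particleInertia P) : ℝ) •
    ![√(particleMass P) * closestDistance P β * angleSin β.elevation,
      -(√(particleMass P) * closestDistance P β * angleCos β.elevation),
      -(√(particleMass P) * closestDistance P β * angleSin β.elevation),
      √(particleMass P) * closestDistance P β * angleCos β.elevation,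
      2 * √(particleInertia P),
      2 * √(particleInertia P)]

/-- The non-canonical scattering family
`σ_β V = M⁻¹ (2 E₁ ⊗ E₁ + 2 E₂ ⊗ E₂ + 2 E_β ⊗ E_β - I) M V`, indexed by the collision
parameter. -/
def nonCanonicalScattering (P : Set Plane) (β : CollisionParameter) (V : Fin 6 → ℝ) :
    Fin 6 → ℝ :=
  ((massInertiaMatrix P)⁻¹ *
    ((2 : ℝ) • Matrix.vecMulVec vecE₁ vecE₁ + (2 : ℝ) • Matrix.vecMulVec vecE₂ vecE₂ +
      (2 : ℝ) • Matrix.vecMulVec (vecEβ P β) (vecEβ P β) - 1) *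
    massInertiaMatrix P).mulVec V

/-- The concatenated velocity `V = [v, v', ω, ω']`. -/
def concatVelocity (v v' : Plane) (ω ω' : ℝ) : Fin 6 → ℝ :=
  ![v 0, v 1, v' 0, v' 1, ω, ω']

/-- `φ` is a collision invariant for the scattering family `σ`: the sum of its values over the two
particles is the same before and after every collision. -/
def IsCollisionInvariant (σ : CollisionParameter → (Fin 6 → ℝ) → (Fin 6 → ℝ))
    (φ : Plane × ℝ × Circle → ℝ) : Prop :=
  ∀ (β : CollisionParameter) (v v' : Plane) (ω ω' : ℝ),
    φ (!₂[σ β (concatVelocity v v' ω ω') 0, σ β (concatVelocity v v' ω ω') 1],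
        σ β (concatVelocity v v' ω ω') 4, β.orientation) +
      φ (!₂[σ β (concatVelocity v v' ω ω') 2, σ β (concatVelocity v v' ω ω') 3],
        σ β (concatVelocity v v' ω ω') 5, β.orientation') =
    φ (v, ω, β.orientation) + φ (v', ω', β.orientation')

end

/-! Freeze one orientation θ for both particles. Of the geometry only m, J > 0 and 0 < d ≤ D
uniformly in the direction are then needed; no regularity of d in ψ enters. With v = c + u, v' = c -
u, tangent n and impulse parameter l, a collision is u ↦ -u + l d n, ω ↦ 2l - ω, ω' ↦ 2l - ω'.
Collisions with l = 0 and n nearly orthogonal to u give infinitesimal relations forcing f(v, ω) =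
F(v) + G(ω) (`eq_add`). Collisions with l d n = u make the two velocities equal and give the
quadratic functional equation for F (`quadratic`). Collisions with n orthogonal to u make the even
part of F radial (`even_sub`). Hence F is constant plus linear plus k m |v|², and a collision that
stops both spins fixes G. Distinct orientations are compared through collisions that merely swap the
velocities, so b and k do not depend on θ. -/

/-! ### Nondegeneracy: positive mass and inertia -/

theorem IsReferenceParticle.nonempty_interior {P : Set Plane} (hP : IsReferenceParticle P) :
    (interior P).Nonempty := by
  rw [hP.convex.interior_nonempty_iff_affineSpan_eq_top]
  by_contra hspan
  obtain ⟨γ, hγ, -, -, hγ', hrange⟩ := hP.boundary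
  -- Without interior, P is its own frontier, so γ runs through all of P, inside a proper affine
  -- subspace.
  have hint : interior P = ∅ := by
    rw [← Set.not_nonempty_iff_eq_empty, hP.convex.interior_nonempty_iff_affineSpan_eq_top]
    exact hspan
  have hrangeP : Set.range γ = P := by
    rw [hrange, frontier, hint, hP.isCompact.isClosed.closure_eq, Set.sdiff_empty]
  have hmem (t : ℝ) : γ t ∈ P := hrangeP ▸ Set.mem_range_self t
  have hdir : (affineSpan ℝ P).direction ≠ ⊤ := by
    intro h
    exact hspan ((AffineSubspace.direction_eq_top_iff_of_nonempty
      ⟨γ 0, subset_affineSpan ℝ P (hmem 0)⟩).1 h)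
  obtain ⟨w, hw, hw0⟩ := (Submodule.ne_bot_iff _).1
    (mt (Submodule.orthogonal_eq_bot_iff (K := (affineSpan ℝ P).direction)).1 hdir)
  have hconst (t : ℝ) : inner ℝ w (γ t) = inner ℝ w (γ 0) := by
    have h := (Submodule.mem_orthogonal' _ _).1 hw (γ t - γ 0)
      (AffineSubspace.vsub_mem_direction (subset_affineSpan ℝ P (hmem t))
        (subset_affineSpan ℝ P (hmem 0)))
    rwa [inner_sub_right, sub_eq_zero] at h
  have hderiv (x : Plane) (t : ℝ) :
      HasDerivAt (fun t => inner ℝ x (γ t)) (inner ℝ x (deriv γ t)) t := by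
    simpa using (hasDerivAt_const t x).inner ℝ
      ((hγ.differentiable one_ne_zero).differentiableAt (x := t)).hasDerivAt
  -- Where γ maximises the form `w'` on P, its velocity is orthogonal to both `w` and `w'`, hence
  -- zero.
  let w' : Plane := !₂[-w 1, w 0]
  obtain ⟨x, hx, hmax⟩ := hP.isCompact.exists_isMaxOn ⟨γ 0, hmem 0⟩
    (f := fun x => inner ℝ w' x) (by fun_prop)
  obtain ⟨t, rfl⟩ : x ∈ Set.range γ := hrangeP ▸ hx
  have h₁ : inner ℝ w (deriv γ t) = 0 := by
    have h := hderiv w t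
    simp only [hconst] at h
    exact h.unique (hasDerivAt_const _ _)
  have h₂ : inner ℝ w' (deriv γ t) = 0 := by
    refine IsLocalMax.hasDerivAt_eq_zero (Filter.Eventually.of_forall fun s => ?_) (hderiv w' t)
    exact hmax (hmem s)
  have hw2 : w 0 ^ 2 + w 1 ^ 2 ≠ 0 := by
    intro h
    apply hw0
    ext i
    fin_cases i <;> simp <;> nlinarith [sq_nonneg (w 0), sq_nonneg (w 1)]
  simp only [PiLp.inner_apply, Fin.sum_univ_two, RCLike.inner_apply, conj_trivial, w',
    Matrix.cons_val_zero, Matrix.cons_val_one] at h₁ h₂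
  apply hγ' t
  ext i
  fin_cases i
  · refine (mul_eq_zero.1 (?_ : (w 0 ^ 2 + w 1 ^ 2) * deriv γ t 0 = 0)).resolve_left hw2
    linear_combination w 0 * h₁ - w 1 * h₂
  · refine (mul_eq_zero.1 (?_ : (w 0 ^ 2 + w 1 ^ 2) * deriv γ t 1 = 0)).resolve_left hw2
    linear_combination w 1 * h₁ + w 0 * h₂

theorem IsReferenceParticle.particleMass_pos {P : Set Plane} (hP : IsReferenceParticle P) :
    0 < particleMass P := by
  have hpos : 0 < volume P :=
    (isOpen_interior.measure_pos volume hP.nonempty_interior).trans_le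
      (measure_mono interior_subset)
  simpa [particleMass, Measure.real] using
    ENNReal.toReal_pos hpos.ne' hP.isCompact.measure_lt_top.ne

theorem IsReferenceParticle.particleInertia_pos {P : Set Plane} (hP : IsReferenceParticle P) :
    0 < particleInertia P := by
  rw [particleInertia, setIntegral_pos_iff_support_of_nonneg_ae
    (Filter.Eventually.of_forall fun y => by positivity)
    ((by fun_prop : Continuous fun y : Plane => ‖y‖ ^ 2).continuousOn.integrableOn_compact
      hP.isCompact)]
  have hsupp : (Function.support fun y : Plane => ‖y‖ ^ 2) = {0}ᶜ := by
    ext y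
    simp
  have hpos : 0 < volume (interior P) :=
    isOpen_interior.measure_pos volume hP.nonempty_interior
  rw [hsupp, Set.inter_comm, ← Set.sdiff_eq, measure_sdiff_null (measure_singleton 0)]
  exact hpos.trans_le (measure_mono interior_subset)

/-! ### Rotations and bounds on the distance of closest approach -/

theorem norm_rotatePlane (θ : Circle) (y : Plane) : ‖rotatePlane θ y‖ = ‖y‖ := by
  have h : angleCos θ ^ 2 + angleSin θ ^ 2 = 1 := by
    have := Circle.normSq_coe θ
    rw [Complex.normSq_apply] at this
    rw [angleCos, angleSin]
    linarith
  rw [EuclideanSpace.norm_eq, EuclideanSpace.norm_eq]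
  congr 1
  simp only [rotatePlane, Fin.sum_univ_two, Real.norm_eq_abs, sq_abs, PiLp.toLp_apply,
    Matrix.cons_val_zero, Matrix.cons_val_one]
  linear_combination (y 0 ^ 2 + y 1 ^ 2) * h

theorem rotatePlane_add (θ : Circle) (x y : Plane) :
    rotatePlane θ (x + y) = rotatePlane θ x + rotatePlane θ y := by
  ext i
  fin_cases i <;> simp [rotatePlane] <;> ring

theorem rotatePlane_rotatePlane_inv (θ : Circle) (y : Plane) :
    rotatePlane θ (rotatePlane θ⁻¹ y) = y := by
  have h : angleCos θ ^ 2 + angleSin θ ^ 2 = 1 := by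
    have := Circle.normSq_coe θ
    rw [Complex.normSq_apply] at this
    rw [angleCos, angleSin]
    linarith
  have hc : angleCos θ⁻¹ = angleCos θ := by simp [angleCos]
  have hs : angleSin θ⁻¹ = -angleSin θ := by simp [angleSin]
  ext i
  fin_cases i <;> simp [rotatePlane, hc, hs]
  · linear_combination y 0 * h
  · linear_combination y 1 * h

theorem norm_direction (ψ : Circle) : ‖direction ψ‖ = 1 := by
  have := Circle.normSq_coe ψ
  rw [Complex.normSq_apply] at this
  rw [EuclideanSpace.norm_eq, Real.sqrt_eq_one]
  simp only [direction, Fin.sum_univ_two, Real.norm_eq_abs, sq_abs, PiLp.toLp_apply,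
    Matrix.cons_val_zero, Matrix.cons_val_one, angleCos, angleSin]
  linarith

/-- For equal orientations the distances of closest approach are positive and bounded. -/
theorem IsReferenceParticle.exists_closestDistance_le {P : Set Plane}
    (hP : IsReferenceParticle P) :
    ∃ D : ℝ, ∀ ψ θ : Circle,
      0 < closestDistance P ⟨ψ, θ, θ⟩ ∧ closestDistance P ⟨ψ, θ, θ⟩ ≤ D := by
  obtain ⟨R, hR0, hR⟩ := hP.isCompact.isBounded.exists_pos_norm_le
  obtain ⟨p, hp⟩ := hP.nonempty_interior
  obtain ⟨r, hr, hball⟩ := Metric.isOpen_iff.1 isOpen_interior p hp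
  refine ⟨3 * R, fun ψ θ => ?_⟩
  have hmem : 3 * R ∈ {d : ℝ | 0 < d ∧ (rotatePlane θ '' P) ∩
      ((fun y => rotatePlane θ y + d • direction ψ) '' P) = ∅} := by
    refine ⟨by positivity, Set.eq_empty_of_forall_notMem ?_⟩
    rintro _ ⟨⟨x, hx, rfl⟩, y, hy, hxy⟩
    have h : (3 * R) • direction ψ = rotatePlane θ x - rotatePlane θ y := by
      rw [← hxy]
      simp
    have h' := norm_sub_le (rotatePlane θ x) (rotatePlane θ y)
    rw [← h, norm_smul, norm_direction, norm_rotatePlane, norm_rotatePlane, Real.norm_eq_abs,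
      abs_of_pos (by positivity)] at h'
    linarith [hR x hx, hR y hy]
  refine ⟨hr.trans_le (le_csInf ⟨_, hmem⟩ ?_), csInf_le ⟨0, fun d hd => hd.1.le⟩ hmem⟩
  rintro d ⟨hd, hempty⟩
  by_contra! hdr
  -- A translation shorter than the inradius at `p` leaves the two copies overlapping.
  have hq : p + rotatePlane θ⁻¹ (d • direction ψ) ∈ P := by
    refine interior_subset (hball ?_)
    simpa [norm_rotatePlane, norm_smul, norm_direction, abs_of_pos hd] using hdr
  refine Set.notMem_empty (rotatePlane θ p + d • direction ψ) ?_
  rw [← hempty]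
  exact ⟨⟨_, hq, by rw [rotatePlane_add, rotatePlane_rotatePlane_inv]⟩, p,
    interior_subset hp, rfl⟩

/-! ### The collision law in mean and relative velocity -/

/-- The tangential unit vector `(sin ψ, -cos ψ)` of a collision. -/
def tangent (ψ : Circle) : Plane := !₂[angleSin ψ, -angleCos ψ]

/-- In terms of the mean velocity `c` and half the relative velocity `u`, a collision acts by
`u ↦ -u + l d n`, `ω ↦ 2 l - ω` and `ω' ↦ 2 l - ω'`. -/
theorem nonCanonicalScattering_concatVelocity {P : Set Plane} (hm : 0 < particleMass P)
    (hJ : 0 < particleInertia P) (β : CollisionParameter) (c u : Plane) (ω ω' l : ℝ)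
    (hl : l * (particleMass P * closestDistance P β ^ 2 + 4 * particleInertia P) =
      2 * (particleMass P * closestDistance P β * inner ℝ (tangent β.elevation) u +
        particleInertia P * (ω + ω'))) :
    nonCanonicalScattering P β (concatVelocity (c + u) (c - u) ω ω') =
      concatVelocity (c - u + (l * closestDistance P β) • tangent β.elevation)
        (c + u - (l * closestDistance P β) • tangent β.elevation) (2 * l - ω) (2 * l - ω') := by
  set d := closestDistance P β with hd
  obtain ⟨a, ha⟩ : ∃ a, a = √(particleMass P) := ⟨_, rfl⟩
  obtain ⟨b, hb⟩ : ∃ b, b = √(particleInertia P) := ⟨_, rfl⟩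
  have ha0 : 0 < a := ha ▸ Real.sqrt_pos.2 hm
  have hb0 : 0 < b := hb ▸ Real.sqrt_pos.2 hJ
  have ha2 : particleMass P = a ^ 2 := by rw [ha, Real.sq_sqrt hm.le]
  have hb2 : particleInertia P = b ^ 2 := by rw [hb, Real.sq_sqrt hJ.le]
  have hM : massInertiaMatrix P = Matrix.diagonal ![a, a, a, a, b, b] := by
    rw [massInertiaMatrix, ha, hb]
  have hdet : IsUnit (massInertiaMatrix P).det := by
    rw [hM, Matrix.det_diagonal, isUnit_iff_ne_zero, Finset.prod_ne_zero_iff]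
    intro i _
    fin_cases i <;> simp [ha0.ne', hb0.ne']
  obtain ⟨r, hr⟩ : ∃ r, r = √(2 * particleMass P * d ^ 2 + 8 * particleInertia P) := ⟨_, rfl⟩
  have hr0 : 0 < r := hr ▸ Real.sqrt_pos.2 (by positivity)
  have hr2 : r ^ 2 = 2 * a ^ 2 * d ^ 2 + 8 * b ^ 2 := by
    rw [hr, Real.sq_sqrt (by positivity), ha2, hb2]
  have hE : vecEβ P β = (1 / r) • ![a * d * angleSin β.elevation,
      -(a * d * angleCos β.elevation), -(a * d * angleSin β.elevation),
      a * d * angleCos β.elevation, 2 * b, 2 * b] := by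
    rw [vecEβ, hr, ha, hb]
  have h2 : (√2)⁻¹ * (√2)⁻¹ = (1 / 2 : ℝ) := by
    rw [← mul_inv, Real.mul_self_sqrt (by norm_num)]
    norm_num
  rw [ha2, hb2] at hl
  -- The coefficient of the `vecEβ` term: it depends on u and ω + ω' only, since `vecEβ` is
  -- orthogonal to the mean velocity.
  have hl' : 2 * (r⁻¹ * r⁻¹) * (2 * a ^ 2 * d * inner ℝ (tangent β.elevation) u +
      2 * b ^ 2 * (ω + ω')) = l := by
    field_simp
    rw [hr2]
    linear_combination -2 * hl
  simp only [tangent, PiLp.inner_apply, Fin.sum_univ_two, RCLike.inner_apply, conj_trivial,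
    Matrix.cons_val_zero, Matrix.cons_val_one] at hl'
  rw [nonCanonicalScattering, ← Matrix.mulVec_mulVec, ← Matrix.mulVec_mulVec]
  suffices h : ((2 : ℝ) • Matrix.vecMulVec vecE₁ vecE₁ + (2 : ℝ) • Matrix.vecMulVec vecE₂ vecE₂ +
      (2 : ℝ) • Matrix.vecMulVec (vecEβ P β) (vecEβ P β) - 1).mulVec
      ((massInertiaMatrix P).mulVec (concatVelocity (c + u) (c - u) ω ω')) =
      (massInertiaMatrix P).mulVec
        (concatVelocity (c - u + (l * d) • tangent β.elevation)
          (c + u - (l * d) • tangent β.elevation) (2 * l - ω) (2 * l - ω')) by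
    rw [h, Matrix.mulVec_mulVec, Matrix.nonsing_inv_mul _ hdet, Matrix.one_mulVec]
  rw [Matrix.sub_mulVec, Matrix.add_mulVec, Matrix.add_mulVec, Matrix.smul_mulVec,
    Matrix.smul_mulVec, Matrix.smul_mulVec, Matrix.vecMulVec_mulVec, Matrix.vecMulVec_mulVec,
    Matrix.vecMulVec_mulVec, Matrix.one_mulVec, hE, hM]
  ext i
  fin_cases i <;>
  simp [Matrix.mulVec_diagonal, concatVelocity, vecE₁, vecE₂, dotProduct, Fin.sum_univ_six,
    tangent]
  · linear_combination (2 * a * (c 0)) * 2 * h2 + a * d * angleSin β.elevation * hl'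
  · linear_combination (2 * a * (c 1)) * 2 * h2 - a * d * angleCos β.elevation * hl'
  · linear_combination (2 * a * (c 0)) * 2 * h2 - a * d * angleSin β.elevation * hl'
  · linear_combination (2 * a * (c 1)) * 2 * h2 + a * d * angleCos β.elevation * hl'
  · linear_combination 2 * b * hl'
  · linear_combination 2 * b * hl'

theorem exists_tangent_eq {n : Plane} (hn : ‖n‖ = 1) : ∃ ψ : Circle, tangent ψ = n := by
  have h : n 0 ^ 2 + n 1 ^ 2 = 1 := by
    have := EuclideanSpace.real_norm_sq_eq n
    rw [hn, Fin.sum_univ_two] at this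
    linarith
  refine ⟨⟨⟨-n 1, n 0⟩, ?_⟩, ?_⟩
  · rw [Submonoid.unitSphere, Submonoid.mem_mk, Subsemigroup.mem_mk, mem_sphere_zero_iff_norm,
      ← sq_eq_sq₀ (norm_nonneg _) zero_le_one, Complex.sq_norm,
      Complex.normSq_apply]
    linear_combination h
  · ext i
    fin_cases i <;> simp [tangent, angleSin, angleCos]

/-- The collision rule for the velocity profiles `f` and `g` of `φ` at two orientations. -/
theorem IsCollisionInvariant.profile {P : Set Plane} (hm : 0 < particleMass P)
    (hJ : 0 < particleInertia P) {φ : Plane × ℝ × Circle → ℝ}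
    (hinv : IsCollisionInvariant (nonCanonicalScattering P) φ) (β : CollisionParameter)
    (c u : Plane) (ω ω' l : ℝ)
    (hl : l * (particleMass P * closestDistance P β ^ 2 + 4 * particleInertia P) =
      2 * (particleMass P * closestDistance P β * inner ℝ (tangent β.elevation) u +
        particleInertia P * (ω + ω'))) :
    φ (c - u + (l * closestDistance P β) • tangent β.elevation, 2 * l - ω, β.orientation) +
      φ (c + u - (l * closestDistance P β) • tangent β.elevation, 2 * l - ω', β.orientation') =
    φ (c + u, ω, β.orientation) + φ (c - u, ω', β.orientation') := by
  have h := hinv β (c + u) (c - u) ω ω'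
  rw [nonCanonicalScattering_concatVelocity hm hJ β c u ω ω' l hl] at h
  rw [← h]
  congr 3 <;> ext i <;> fin_cases i <;> rfl

/-- The collision invariants of two equally oriented particles of mass `m` and inertia `J`: to
every unit vector `n` there is a distance `d ∈ (0, D]` such that the collision with tangent `n`
and distance `d` conserves the sum of the values of `f`. -/
def IsProfileInvariant (m J D : ℝ) (f : Plane → ℝ → ℝ) : Prop :=
  ∀ n : Plane, ‖n‖ = 1 → ∃ d, 0 < d ∧ d ≤ D ∧ ∀ (c u : Plane) (ω ω' l : ℝ),
    l * (m * d ^ 2 + 4 * J) = 2 * (m * d * inner ℝ n u + J * (ω + ω')) →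
    f (c - u + (l * d) • n) (2 * l - ω) + f (c + u - (l * d) • n) (2 * l - ω') =
      f (c + u) ω + f (c - u) ω'

/-! ### Functional equations and auxiliary directions -/

/-- A function with Jensen's equation whose value at `0` is `0` is additive. -/
theorem map_add_of_jensen {E : Type*} [AddCommGroup E] [Module ℝ E] {g : E → ℝ} (h0 : g 0 = 0)
    (h : ∀ c u, g (c + u) + g (c - u) = 2 * g c) (x y : E) : g (x + y) = g x + g y := by
  have h₁ := h ((1 / 2 : ℝ) • (x + y)) ((1 / 2 : ℝ) • (x + y))
  have h₂ := h ((1 / 2 : ℝ) • (x + y)) ((1 / 2 : ℝ) • (x - y))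
  rw [sub_self, h0, show (1 / 2 : ℝ) • (x + y) + (1 / 2 : ℝ) • (x + y) = x + y by module] at h₁
  rw [show (1 / 2 : ℝ) • (x + y) + (1 / 2 : ℝ) • (x - y) = x by module,
    show (1 / 2 : ℝ) • (x + y) - (1 / 2 : ℝ) • (x - y) = y by module] at h₂
  linarith

theorem exists_inner_eq_of_jensen {g : Plane → ℝ} (hg : Continuous g) (h0 : g 0 = 0)
    (h : ∀ c u, g (c + u) + g (c - u) = 2 * g c) : ∃ b : Plane, ∀ x, g x = inner ℝ b x := by
  let L : Plane →L[ℝ] ℝ :=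
    (AddMonoidHom.mk' g (map_add_of_jensen h0 h)).toRealLinearMap hg
  refine ⟨(InnerProductSpace.toDual ℝ Plane).symm L, fun x => ?_⟩
  rw [InnerProductSpace.toDual_symm_apply]
  rfl

/-- A `C¹` solution of the quadratic functional equation on the line. -/
theorem exists_eq_mul_sq {e : ℝ → ℝ} (he : ContDiff ℝ 1 e)
    (h : ∀ s t, e (s + t) + e (s - t) = 2 * e s + 2 * e t) : ∃ k : ℝ, ∀ t, e t = k * t ^ 2 := by
  have hd (t : ℝ) : HasDerivAt e (deriv e t) t :=
    ((he.differentiable one_ne_zero).differentiableAt).hasDerivAt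
  have he0 : e 0 = 0 := by
    have := h 0 0
    simp only [add_zero, sub_zero] at this
    linarith
  -- Differentiation in s removes the term 2 e(t) and leaves Jensen's equation for e'.
  have hjensen (s t : ℝ) : deriv e (s + t) + deriv e (s - t) = 2 * deriv e s := by
    have h₁ := ((hd (s + t)).comp_add_const s t).add ((hd (s - t)).comp_sub_const s t)
    have h₂ := ((hd s).const_mul 2).add_const (2 * e t)
    exact h₁.unique (h₂.congr_of_eventuallyEq (Filter.Eventually.of_forall fun s => h s t))
  have hd0 : deriv e 0 = 0 := by
    have heven (t : ℝ) : e (-t) = e t := by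
      have := h 0 t
      simp only [zero_add, zero_sub, he0] at this
      linarith
    have h₁ := deriv_comp_neg e 0
    simp only [heven, neg_zero] at h₁
    linarith
  let L : ℝ →L[ℝ] ℝ := (AddMonoidHom.mk' (deriv e) (map_add_of_jensen hd0 hjensen)).toRealLinearMap
    he.continuous_deriv_one
  have hL (t : ℝ) : deriv e t = L 1 * t := by
    have : L t = L (t • 1) := by simp
    rw [L.map_smul, smul_eq_mul, mul_comm] at this
    exact this
  refine ⟨L 1 / 2, fun t => ?_⟩
  have hz (t : ℝ) : HasDerivAt (fun t => e t - L 1 / 2 * t ^ 2) 0 t := by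
    refine ((hd t).sub ((hasDerivAt_pow 2 t).const_mul (L 1 / 2))).congr_deriv ?_
    rw [hL]
    norm_num
    ring
  have := is_const_of_deriv_eq_zero (fun t => (hz t).differentiableAt) (fun t => (hz t).deriv) t 0
  simp only [he0] at this
  linarith

/-- A function that is additive on orthogonal differences is radial. -/
theorem eq_of_norm_eq_of_orthogonal_additive {g : Plane → ℝ}
    (h : ∀ a b, inner ℝ a b = 0 → g (a - b) = g a + g b) (heven : ∀ a, g (-a) = g a)
    {x y : Plane} (hxy : ‖x‖ = ‖y‖) : g x = g y := by
  -- Vectors of equal norm are a + b and a - b with a orthogonal to b.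
  have horth : inner ℝ ((1 / 2 : ℝ) • (x + y)) ((1 / 2 : ℝ) • (x - y)) = 0 := by
    rw [inner_smul_left, inner_smul_right, (real_inner_add_sub_eq_zero_iff x y).2 hxy]
    simp
  have h₁ := h _ _ horth
  have h₂ := h _ (-((1 / 2 : ℝ) • (x - y))) (by rw [inner_neg_right, horth, neg_zero])
  rw [show (1 / 2 : ℝ) • (x + y) - (1 / 2 : ℝ) • (x - y) = y by module] at h₁
  rw [show (1 / 2 : ℝ) • (x + y) - -((1 / 2 : ℝ) • (x - y)) = x by module, heven] at h₂
  rw [h₁, h₂]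

/-- Every nonzero vector has arbitrarily small nonzero projections to unit directions. -/
theorem exists_unit_inner_small {u : Plane} (hu : u ≠ 0) {ε : ℝ} (hε : 0 < ε) :
    ∃ n : Plane, ‖n‖ = 1 ∧ inner ℝ n u ≠ 0 ∧ |inner ℝ n u| < ε := by
  have hu' : 0 < ‖u‖ := norm_pos_iff.2 hu
  have hsq : u 0 ^ 2 + u 1 ^ 2 = ‖u‖ ^ 2 := by
    rw [EuclideanSpace.real_norm_sq_eq, Fin.sum_univ_two]
  obtain ⟨t, ht0, htε, ht1⟩ : ∃ t : ℝ, 0 < t ∧ t * ‖u‖ < ε ∧ t ≤ 1 := by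
    refine ⟨min 1 (ε / (2 * ‖u‖)), by positivity, ?_, min_le_left _ _⟩
    calc min 1 (ε / (2 * ‖u‖)) * ‖u‖ ≤ ε / (2 * ‖u‖) * ‖u‖ := by
          gcongr
          exact min_le_right _ _
      _ = ε / 2 := by field_simp
      _ < ε := by linarith
  have hs := Real.sin_le ht0.le
  have hs0 : 0 < Real.sin t := Real.sin_pos_of_pos_of_le_one ht0 ht1
  -- The direction of u turned by π/2 - t.
  let n : Plane := !₂[(Real.sin t * u 0 - Real.cos t * u 1) / ‖u‖,
    (Real.sin t * u 1 + Real.cos t * u 0) / ‖u‖]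
  have hinner : inner ℝ n u = Real.sin t * ‖u‖ := by
    simp only [n, PiLp.inner_apply, Fin.sum_univ_two, RCLike.inner_apply, conj_trivial,
      Matrix.cons_val_zero, Matrix.cons_val_one]
    field_simp
    linear_combination Real.sin t * hsq
  refine ⟨n, ?_, ?_, ?_⟩
  · rw [EuclideanSpace.norm_eq, Real.sqrt_eq_one]
    simp only [n, Fin.sum_univ_two, Real.norm_eq_abs, sq_abs, Matrix.cons_val_zero,
      Matrix.cons_val_one]
    field_simp
    linear_combination (u 0 ^ 2 + u 1 ^ 2) * Real.sin_sq_add_cos_sq t + hsq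
  · rw [hinner]
    positivity
  · rw [hinner, abs_of_pos (by positivity)]
    exact (mul_le_mul_of_nonneg_right hs hu'.le).trans_lt htε

/-! ### Invariants at a single orientation -/

namespace IsProfileInvariant

variable {m J D : ℝ} {f : Plane → ℝ → ℝ}

/-- The derivatives in the angular velocity at two different velocities are opposite. -/
theorem deriv_eq_neg (hm : 0 < m) (hJ : 0 < J) (h : IsProfileInvariant m J D f)
    (hf : ∀ v, Differentiable ℝ (f v)) {x y : Plane} (hxy : x ≠ y) (ω : ℝ) :
    deriv (f x) ω = -deriv (f y) (-ω) := by
  obtain ⟨c, u, rfl, rfl⟩ : ∃ c u, x = c + u ∧ y = c - u :=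
    ⟨(1 / 2 : ℝ) • (x + y), (1 / 2 : ℝ) • (x - y), by module, by module⟩
  have hu : u ≠ 0 := by
    rintro rfl
    simp at hxy
  have h₁ : HasDerivAt (fun s => f (c + u) (ω - s)) (-deriv (f (c + u)) ω) 0 :=
    HasDerivAt.comp_const_sub ω 0 (by simpa using ((hf (c + u)) ω).hasDerivAt)
  have h₂ : HasDerivAt (fun s => f (c - u) (-ω + s)) (deriv (f (c - u)) (-ω)) 0 :=
    HasDerivAt.comp_const_add (-ω) 0 (by simpa using ((hf (c - u)) (-ω)).hasDerivAt)
  -- A nonzero derivative of s ↦ f(x, ω - s) - f(y, -ω + s) at 0 would keep its value at 0 from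
  -- recurring nearby. Collisions with l = 0 make it recur at s = -m d ⟨n, u⟩ / J, nonzero and,
  -- thanks to d ≤ D, arbitrarily small.
  by_contra hne
  have hev := (h₁.sub h₂).eventually_ne (c := f (c + u) ω - f (c - u) (-ω))
    (fun h0 => hne (by linarith))
  rw [eventually_nhdsWithin_iff, Metric.eventually_nhds_iff] at hev
  obtain ⟨ε, hε, hev⟩ := hev
  have hD : 0 < D := by
    obtain ⟨n, hn, -⟩ := exists_unit_inner_small hu one_pos
    obtain ⟨d, hd, hdD, -⟩ := h n hn
    exact hd.trans_le hdD
  obtain ⟨n, hn, hn0, hnε⟩ := exists_unit_inner_small hu (ε := ε * J / (m * D)) (by positivity)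
  obtain ⟨d, hd, hdD, h⟩ := h n hn
  have hs : -(m * d * inner ℝ n u / J) ≠ 0 :=
    neg_ne_zero.2 (div_ne_zero (mul_ne_zero (by positivity) hn0) hJ.ne')
  refine hev (y := -(m * d * inner ℝ n u / J)) ?_ hs ?_
  · rw [dist_zero_right, norm_neg, Real.norm_eq_abs, abs_div, abs_mul,
      abs_of_pos (by positivity : 0 < m * d), abs_of_pos hJ, div_lt_iff₀ hJ]
    rw [lt_div_iff₀ (by positivity)] at hnε
    calc m * d * |inner ℝ n u| ≤ m * D * |inner ℝ n u| := by gcongr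
      _ < ε * J := by linarith
  · have := h c u ω (-ω + -(m * d * inner ℝ n u / J)) 0 (by field_simp; ring)
    simp only [zero_mul, mul_zero, zero_smul, add_zero, sub_zero, zero_sub] at this
    rw [show -(-ω + -(m * d * inner ℝ n u / J)) = ω - -(m * d * inner ℝ n u / J) by ring] at this
    simp only [Pi.sub_apply]
    linarith

/-- The dependences on the two velocities separate. -/
theorem eq_add (hm : 0 < m) (hJ : 0 < J) (h : IsProfileInvariant m J D f)
    (hf : ∀ v, Differentiable ℝ (f v)) (v : Plane) (ω : ℝ) :
    f v ω = f v 0 + (f 0 ω - f 0 0) := by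
  -- Passing through a third velocity cancels both sign changes.
  obtain ⟨y, hy⟩ := Set.Infinite.exists_notMem_finset (Set.infinite_univ (α := Plane)) {v, 0}
  simp only [Set.mem_univ, true_and, Finset.mem_insert, Finset.mem_singleton, not_or] at hy
  have hderiv (t : ℝ) : deriv (f v) t = deriv (f 0) t := by
    rw [h.deriv_eq_neg hm hJ hf (Ne.symm hy.1), h.deriv_eq_neg hm hJ hf (Ne.symm hy.2)]
  have := is_const_of_deriv_eq_zero ((hf v).sub (hf 0)) (fun t => by
    rw [deriv_sub (hf v t) (hf 0 t), hderiv, sub_self]) ω 0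
  simp only [Pi.sub_apply] at this
  linarith

/-- The quadratic functional equation of the dependence on the velocity. -/
theorem quadratic (hm : 0 < m) (hJ : 0 < J) (h : IsProfileInvariant m J D f)
    (hf : ∀ v, Differentiable ℝ (f v)) (c u : Plane) :
    f (c + u) 0 + f (c - u) 0 = 2 * f c 0 + (f u 0 + f (-u) 0 - 2 * f 0 0) := by
  rcases eq_or_ne u 0 with rfl | hu
  · simp
    ring
  have hu' : 0 < ‖u‖ := norm_pos_iff.2 hu
  obtain ⟨d, hd, -, h'⟩ := h (‖u‖⁻¹ • u) (norm_smul_inv_norm (𝕜 := ℝ) hu)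
  have hinner : inner ℝ (‖u‖⁻¹ • u) u = ‖u‖ := by
    rw [real_inner_smul_left, real_inner_self_eq_norm_sq]
    field_simp
  -- The spin `s` tunes l to ‖u‖ / d, so both particles leave with velocity c. The spins do not
  -- depend on c, so comparison with c = 0 eliminates them.
  obtain ⟨s, hs⟩ : ∃ s : ℝ, ‖u‖ / d * (m * d ^ 2 + 4 * J) = 2 * (m * d * ‖u‖ + J * (s + 0)) :=
    ⟨(‖u‖ / d * (m * d ^ 2 + 4 * J) - 2 * (m * d * ‖u‖)) / (2 * J), by field_simp; ring⟩
  have hsmul : (‖u‖ / d * d) • ‖u‖⁻¹ • u = u := by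
    rw [div_mul_cancel₀ _ hd.ne', smul_smul, mul_inv_cancel₀ hu'.ne', one_smul]
  have key (c : Plane) := h' c u s 0 (‖u‖ / d) (by rw [hinner, hs])
  simp only [hsmul, sub_add_cancel, add_sub_cancel_right] at key
  have h₁ := key c
  have h₂ := key 0
  rw [h.eq_add hm hJ hf c, h.eq_add hm hJ hf c (2 * (‖u‖ / d) - 0),
    h.eq_add hm hJ hf (c + u) s] at h₁
  rw [zero_add, zero_sub, h.eq_add hm hJ hf u s] at h₂
  linarith

/-- The even part of the dependence on the velocity is additive on orthogonal differences. -/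
theorem even_sub (hm : 0 < m) (hJ : 0 < J) (h : IsProfileInvariant m J D f)
    (hf : ∀ v, Differentiable ℝ (f v)) {a b : Plane} (hab : inner ℝ a b = 0) :
    f (a - b) 0 + f (-(a - b)) 0 + 2 * f 0 0 = f a 0 + f (-a) 0 + (f b 0 + f (-b) 0) := by
  rcases eq_or_ne a 0 with rfl | ha
  · simp
    ring
  have ha' : 0 < ‖a‖ := norm_pos_iff.2 ha
  obtain ⟨d, hd, -, h'⟩ := h (‖a‖⁻¹ • a) (norm_smul_inv_norm (𝕜 := ℝ) ha)
  -- Here l d n = a. As b is orthogonal to n, the same spins serve for b and for 0, and subtraction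
  -- eliminates them.
  obtain ⟨s, hs⟩ : ∃ s : ℝ, ‖a‖ / d * (m * d ^ 2 + 4 * J) = 2 * (m * d * 0 + J * (s + 0)) :=
    ⟨‖a‖ / d * (m * d ^ 2 + 4 * J) / (2 * J), by field_simp; ring⟩
  have hsmul : (‖a‖ / d * d) • ‖a‖⁻¹ • a = a := by
    rw [div_mul_cancel₀ _ hd.ne', smul_smul, mul_inv_cancel₀ ha'.ne', one_smul]
  have key (b : Plane) (hb : inner ℝ a b = 0) := h' 0 b s 0 (‖a‖ / d)
    (by rw [real_inner_smul_left, hb, mul_zero, hs])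
  simp only [hsmul] at key
  have h₁ := key b hab
  have h₂ := key 0 (inner_zero_right _)
  rw [show 0 - b + a = a - b by abel, show 0 + b - a = -(a - b) by abel, zero_add, zero_sub,
    h.eq_add hm hJ hf (a - b), h.eq_add hm hJ hf (-(a - b)), h.eq_add hm hJ hf b s] at h₁
  rw [sub_zero, zero_add, add_zero, zero_sub, h.eq_add hm hJ hf a,
    h.eq_add hm hJ hf (-a)] at h₂
  linarith

theorem exists_eq (hm : 0 < m) (hJ : 0 < J) (h : IsProfileInvariant m J D f)
    (hf : ∀ v, Differentiable ℝ (f v)) (hf0 : ContDiff ℝ 1 fun v => f v 0) :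
    ∃ (b : Plane) (k : ℝ), ∀ v ω, f v ω = f 0 0 + inner ℝ b v + k * (m * ‖v‖ ^ 2 + J * ω ^ 2) := by
  have hquad := h.quadratic hm hJ hf
  obtain ⟨b, hb⟩ := exists_inner_eq_of_jensen (g := fun v => (f v 0 - f (-v) 0) / 2)
    (by have := hf0.continuous; fun_prop) (by simp) (fun c u => by
      have h₁ := hquad c u
      have h₂ := hquad (-c) u
      rw [show -(c + u) = -c - u by abel, show -(c - u) = -c + u by abel]
      linarith)
  let g : Plane → ℝ := fun v => (f v 0 + f (-v) 0) / 2 - f 0 0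
  have hgquad (c u : Plane) : g (c + u) + g (c - u) = 2 * g c + 2 * g u := by
    have h₁ := hquad c u
    have h₂ := hquad (-c) u
    simp only [g]
    rw [show -(c + u) = -c - u by abel, show -(c - u) = -c + u by abel]
    linarith
  obtain ⟨n, hn⟩ : ∃ n : Plane, ‖n‖ = 1 := exists_norm_eq Plane zero_le_one
  obtain ⟨k, hk⟩ := exists_eq_mul_sq (e := fun t => g (t • n)) (by
    have h₁ : ContDiff ℝ 1 fun t : ℝ => f (t • n) 0 := hf0.comp (by fun_prop)
    have h₂ : ContDiff ℝ 1 fun t : ℝ => f (-(t • n)) 0 := hf0.comp (by fun_prop)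
    exact ((h₁.add h₂).div_const 2).sub contDiff_const) (fun s t => by
      simp only [add_smul, sub_smul, hgquad])
  have hg (v : Plane) : g v = k * ‖v‖ ^ 2 := by
    rw [← hk]
    refine eq_of_norm_eq_of_orthogonal_additive (fun a b hab => ?_) (fun a => ?_) ?_
    · have := h.even_sub hm hJ hf hab
      simp only [g]
      linarith
    · simp only [g, neg_neg]
      ring
    · rw [norm_smul, hn, norm_norm, mul_one]
  have hv (v : Plane) : f v 0 = f 0 0 + inner ℝ b v + k * ‖v‖ ^ 2 := by
    have h₁ := hb v
    have h₂ := hg v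
    simp only [g] at h₁ h₂
    linarith
  have hω (ω : ℝ) : f 0 ω = f 0 0 + k / m * (J * ω ^ 2) := by
    obtain ⟨d, hd, -, h'⟩ := h n hn
    -- This `p` makes l = ω / 2, so that both outgoing spins vanish.
    obtain ⟨p, hp⟩ : ∃ p, p = ω * (m * d ^ 2 - 4 * J) / (4 * m * d) := ⟨_, rfl⟩
    have key := h' 0 (p • n) ω ω (ω / 2) (by
      rw [real_inner_smul_right, real_inner_self_eq_norm_sq, hn, hp]
      field_simp
      ring)
    rw [show 0 - p • n + (ω / 2 * d) • n = (ω / 2 * d - p) • n by module,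
      show 0 + p • n - (ω / 2 * d) • n = -((ω / 2 * d - p) • n) by module, zero_add, zero_sub,
      mul_div_cancel₀ ω two_ne_zero, sub_self, h.eq_add hm hJ hf (p • n),
      h.eq_add hm hJ hf (-(p • n)), hv (_ • n), hv (-(_ • n)), hv (p • n), hv (-(p • n))] at key
    simp only [norm_neg, norm_smul, hn, inner_neg_right, Real.norm_eq_abs, mul_one, sq_abs] at key
    have hcalc : (ω / 2 * d - p) ^ 2 - p ^ 2 = J * ω ^ 2 / m := by
      rw [hp]
      field_simp
      ring
    linear_combination -key / 2 + k * hcalc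
  refine ⟨b, k / m, fun v ω => ?_⟩
  rw [h.eq_add hm hJ hf v ω, hv, hω ω]
  field_simp
  ring

end IsProfileInvariant

/-! ### Independence of the orientation -/

theorem theorem1p1 (P : Set Plane) (hP : IsReferenceParticle P)
    (φ : Plane × ℝ × Circle → ℝ)
    (hφ : ContMDiff (𝓘(ℝ, Plane).prod (𝓘(ℝ, ℝ).prod (𝓡 1))) 𝓘(ℝ, ℝ) 1 φ)
    (hinv : IsCollisionInvariant (nonCanonicalScattering P) φ) :
    ∃ (a : Circle → ℝ) (b : Plane) (c : ℝ),
      ContMDiff (𝓡 1) 𝓘(ℝ, ℝ) 1 a ∧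
      ∀ (v : Plane) (ω : ℝ) (θ : Circle),
        φ (v, ω, θ) =
          a θ + inner ℝ b v + c * (particleMass P * ‖v‖ ^ 2 + particleInertia P * ω ^ 2) := by
  have hm := hP.particleMass_pos
  have hJ := hP.particleInertia_pos
  obtain ⟨D, hD⟩ := hP.exists_closestDistance_le
  have hprofile (θ : Circle) :
      IsProfileInvariant (particleMass P) (particleInertia P) D fun v ω => φ (v, ω, θ) := by
    intro n hn
    obtain ⟨ψ, rfl⟩ := exists_tangent_eq hn
    exact ⟨_, (hD ψ θ).1, (hD ψ θ).2, hinv.profile hm hJ ⟨ψ, θ, θ⟩⟩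
  have hexists (θ : Circle) := (hprofile θ).exists_eq hm hJ
    (fun v => ContDiff.differentiable (n := 1) (ContMDiff.contDiff
      (hφ.comp (contMDiff_const.prodMk (contMDiff_id.prodMk contMDiff_const)))) one_ne_zero)
    (ContMDiff.contDiff (hφ.comp (contMDiff_id.prodMk contMDiff_const)))
  choose b k hbk using hexists
  -- With zero spins and n orthogonal to u one has l = 0: the velocities are swapped whatever d is,
  -- so no bound on d for distinct orientations is needed.
  have hcompare (θ θ' : Circle) (c u : Plane) :
      inner ℝ (b θ - b θ') u + 2 * (k θ - k θ') * particleMass P * inner ℝ c u = 0 := by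
    obtain ⟨n, hn, hnu⟩ : ∃ n : Plane, ‖n‖ = 1 ∧ inner ℝ n u = 0 := by
      rcases eq_or_ne u 0 with rfl | hu
      · obtain ⟨n, hn⟩ : ∃ n : Plane, ‖n‖ = 1 := exists_norm_eq Plane zero_le_one
        exact ⟨n, hn, inner_zero_right n⟩
      let w : Plane := !₂[-u 1, u 0]
      have hw : w ≠ 0 := by
        intro hw
        apply hu
        ext i
        fin_cases i
        · simpa [w] using congr($hw 1)
        · simpa [w] using congr($hw 0)
      refine ⟨‖w‖⁻¹ • w, norm_smul_inv_norm (𝕜 := ℝ) hw, ?_⟩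
      rw [real_inner_smul_left]
      refine mul_eq_zero_of_right _ ?_
      simp [w, PiLp.inner_apply, Fin.sum_univ_two]
      ring
    obtain ⟨ψ, rfl⟩ := exists_tangent_eq hn
    have := hinv.profile hm hJ ⟨ψ, θ, θ'⟩ c u 0 0 0 (by simp [hnu])
    simp only [zero_mul, mul_zero, zero_smul, add_zero, sub_zero, hbk θ (c + u), hbk θ (c - u),
      hbk θ' (c + u), hbk θ' (c - u), inner_add_right, inner_sub_right, norm_add_sq_real,
      norm_sub_sq_real] at this
    rw [inner_sub_left]
    linear_combination -this / 2
  have hb (θ : Circle) : b θ = b 1 := by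
    have := hcompare θ 1 0 (b θ - b 1)
    rw [inner_zero_left, mul_zero, add_zero, inner_self_eq_zero] at this
    exact sub_eq_zero.1 this
  have hk (θ : Circle) : k θ = k 1 := by
    obtain ⟨n, hn⟩ : ∃ n : Plane, ‖n‖ = 1 := exists_norm_eq Plane zero_le_one
    have := hcompare θ 1 n n
    rw [hb, sub_self, inner_zero_left, real_inner_self_eq_norm_sq, hn] at this
    have h' : (k θ - k 1) * particleMass P = 0 := by linarith
    exact sub_eq_zero.1 ((mul_eq_zero.1 h').resolve_right hm.ne')
  refine ⟨fun θ => φ (0, 0, θ), b 1, k 1,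
    hφ.comp (contMDiff_const.prodMk (contMDiff_const.prodMk contMDiff_id)), fun v ω θ => ?_⟩
  rw [hbk θ v ω, hb, hk]
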